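/- All graphs are finite and simple. A connected graph is called unicyclic if it contains exactly one cycle. In a connected graph $G$ with distance function $d_G$, a set $S \subseteq V(G)$ is a resolving set if for any two distinct vertices $x,y \in V(G)$ there is $s \in S$ with $d_G(x,s) \neq d_G(y,s)$; a metric basis of $G$ is a resolving set of smallest possible cardinality, and a vertex is a basis forced vertex of $G$ if it belongs to every metric basis of $G$. Let $G$ be a unicyclic graph with cycle $C = v_0 v_1 \cdots v_{g-1} v_0$, let $i \in \{0, \ldots, g-1\}$, and let $H$ be the graph obtained from $G$ by attaching one pendant $u$ to $v_i$, i.e. by adding a new vertex $u$ and the single edge $u v_i$. If $v_i$ is a basis forced vertex of $G$, then $u$ is a basis forced vertex of $H$. -/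

import Mathlib

namespace PendantForced

variable {V : Type*}

/-- A simple graph is unicyclic if it is connected and has exactly one cycle: it has a cycle, and
any two cycles (as closed walks, up to base point and orientation) have the same edges. -/
def IsUnicyclic (G : SimpleGraph V) : Prop :=
  G.Connected ∧ ∃ (a : V) (c : G.Walk a a), c.IsCycle ∧
    ∀ (b : V) (d : G.Walk b b), d.IsCycle → d.edgeSet = c.edgeSet

/-- The vertex `v` lies on a cycle of `G`. -/
def IsCycleVertex (G : SimpleGraph V) (v : V) : Prop :=
  ∃ (a : V) (c : G.Walk a a), c.IsCycle ∧ v ∈ c.support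

/-- The vertex `s` resolves `x` and `y` if its distances to `x` and `y` differ. -/
def Resolves (G : SimpleGraph V) (s x y : V) : Prop :=
  G.dist x s ≠ G.dist y s

/-- Any two distinct vertices are resolved by a vertex of `S`. -/
def IsResolvingSet (G : SimpleGraph V) (S : Finset V) : Prop :=
  ∀ x y : V, x ≠ y → ∃ s ∈ S, Resolves G s x y

/-- A metric basis is a resolving set of the smallest possible cardinality. -/
def IsMetricBasis (G : SimpleGraph V) (S : Finset V) : Prop :=
  IsResolvingSet G S ∧ ∀ T : Finset V, IsResolvingSet G T → S.card ≤ T.card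

/-- A basis forced vertex is one that belongs to every metric basis. -/
def IsBasisForced (G : SimpleGraph V) (v : V) : Prop :=
  ∀ S : Finset V, IsMetricBasis G S → v ∈ S

/-- The adjacency relation of the graph obtained from `G` by adding one new vertex `none`, whose
only neighbour is `some v`. -/
def pendantAdj (G : SimpleGraph V) (v : V) : Option V → Option V → Prop
  | some a, some b => G.Adj a b
  | some a, none => a = v
  | none, some b => b = v
  | none, none => False

/-- The graph obtained from `G` by attaching one pendant, the vertex `none`, to the vertex `v`. -/
def attachPendant (G : SimpleGraph V) (v : V) : SimpleGraph (Option V) where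
  Adj := pendantAdj G v
  symm := ⟨by
    rintro (_ | a) (_ | b) h
    · exact h
    · exact h
    · exact h
    · exact G.adj_symm h⟩
  loopless := ⟨by
    rintro (_ | a) h
    · exact h
    · exact G.irrefl h⟩

end PendantForced

/-! Suppose a metric basis of `H` avoids the pendant `u`. Its members resolve `G`. Every metric
basis of `G` contains `v`, and exchanging `v` for `u` shows that `H` needs no more vertices than
`G`. So the set is also a metric basis of `G`; it contains `v`, and it resolves `u` from all
vertices of `G`. `exists_isResolvingSet_notMem` turns such a set into one no larger that avoids `v`,
a contradiction. That lemma works with tree positions and heights along the cycle, with `v = c 0`.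
If another member hangs in the tree at `v`, then `v` is redundant. Otherwise `v` is traded for some
`c w`. Since `v` separates only vertices with different coordinates, it suffices that the new
positions doubly resolve the cycle. Resolving `u` from the two cycle neighbours of `v` settles the
cases where the members have too few positions. -/

namespace PendantForced

/-! ### Doubly resolving positions on a cycle -/

/-- The distance between the positions `i` and `j` on a cycle of length `g`. -/
def cycDist (g i j : ℕ) : ℕ := min (i - j + (j - i)) (g - (i - j + (j - i)))

theorem cycDist_comm (g i j : ℕ) : cycDist g i j = cycDist g j i := by
  unfold cycDist; omega

theorem cycDist_self (g i : ℕ) : cycDist g i i = 0 := by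
  unfold cycDist; omega

theorem cycDist_pos {g i j : ℕ} (hi : i < g) (hj : j < g) (hij : i ≠ j) : 0 < cycDist g i j := by
  unfold cycDist; omega

theorem two_mul_cycDist_le (g i j : ℕ) : 2 * cycDist g i j ≤ g := by
  unfold cycDist; omega

theorem cycDist_triangle {g i j k : ℕ} (hi : i < g) (hj : j < g) (hk : k < g) :
    cycDist g i k ≤ cycDist g i j + cycDist g j k := by
  unfold cycDist; omega

/-- The arcs between `p` and `q` have lengths `k` and `k + 1`, and `a` lies on one of them. -/
theorem cycDist_add_le {k p q a : ℕ} (hp : p < 2 * k + 1) (hq : q < 2 * k + 1)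
    (ha : a < 2 * k + 1) (hpq : cycDist (2 * k + 1) p q = k) :
    cycDist (2 * k + 1) a p + cycDist (2 * k + 1) a q ≤ k + 1 := by
  unfold cycDist at *; omega

/-- Equidistant positions are mirror images in the axis through `t`, so `a + b ≡ 2t` modulo `g`. -/
theorem reflection_of_cycDist_eq {g a b t : ℕ} (ha : a < g) (hb : b < g) (ht : t < g)
    (hab : a ≠ b) (h : cycDist g a t = cycDist g b t) :
    a + b = 2 * t ∨ a + b + g = 2 * t ∨ a + b = 2 * t + g := by
  unfold cycDist at *; omega

/-- The positions `a` and `b` cannot be the projections of two vertices, the first one lower by `e`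
than the second one, that have the same distance to vertices which project to each `t ∈ W`. -/
def DoublyResolves (g : ℕ) (W : Set ℕ) : Prop :=
  ∀ a < g, ∀ b < g, ∀ e, a ≠ b →
    -- The cases `t = b` and `t = a` are exempt: within one tree, coordinates only bound the
    -- distance from above.
    (∀ t ∈ W, (t = b ∨ cycDist g b t + e ≤ cycDist g a t) ∧
      (e = 0 → t = a ∨ cycDist g a t ≤ cycDist g b t)) → False

/-- The distances to `p` and `q` sum to at least `k` from `b` and at most `k + 1` from `a`, which
leaves only `e = 0`. Then `2p ≡ 2q` modulo an odd number, so `p = q`. -/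
theorem doublyResolves_pair {k p q : ℕ} (hp : p < 2 * k + 1) (hq : q < 2 * k + 1) (hk : 0 < k)
    (hpq : cycDist (2 * k + 1) p q = k) : DoublyResolves (2 * k + 1) {p, q} := by
  intro a ha b hb e hab H
  obtain ⟨Hp, Hp'⟩ := H p (by simp)
  obtain ⟨Hq, Hq'⟩ := H q (by simp)
  have tri := cycDist_triangle hp hb hq
  rw [hpq, cycDist_comm _ p b] at tri
  have up := cycDist_add_le hp hq ha hpq
  have z1 := two_mul_cycDist_le (2 * k + 1) a p
  have z2 := two_mul_cycDist_le (2 * k + 1) a q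
  have z3 := two_mul_cycDist_le (2 * k + 1) b p
  have z4 := two_mul_cycDist_le (2 * k + 1) b q
  have bp : p = b → cycDist (2 * k + 1) b p = 0 := by rintro rfl; exact cycDist_self _ _
  have bq : q = b → cycDist (2 * k + 1) b q = 0 := by rintro rfl; exact cycDist_self _ _
  have ap : p = a → cycDist (2 * k + 1) a p = 0 := by rintro rfl; exact cycDist_self _ _
  have aq : q = a → cycDist (2 * k + 1) a q = 0 := by rintro rfl; exact cycDist_self _ _
  have dp : p = b → 0 < cycDist (2 * k + 1) a p := by rintro rfl; exact cycDist_pos ha hp hab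
  have dq : q = b → 0 < cycDist (2 * k + 1) a q := by rintro rfl; exact cycDist_pos ha hq hab
  have hne : p ≠ q := by rintro rfl; rw [cycDist_self] at hpq; omega
  have e1 : cycDist (2 * k + 1) a p = cycDist (2 * k + 1) b p ∧
      cycDist (2 * k + 1) a q = cycDist (2 * k + 1) b q := by omega
  have r1 := reflection_of_cycDist_eq ha hb hp hab e1.1
  have r2 := reflection_of_cycDist_eq ha hb hq hab e1.2
  omega

/-- No gap exceeds half the cycle, so the arc containing `a` is a geodesic. -/
theorem exists_arc {g p q w a : ℕ} (hpq : p < q) (hqw : q < w) (hw : w < g) (ha : a < g)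
    (h1 : 2 * (q - p) ≤ g) (h2 : 2 * (w - q) ≤ g) (h3 : g ≤ 2 * (w - p)) :
    cycDist g a p + cycDist g a q = cycDist g p q ∨ cycDist g a q + cycDist g a w = cycDist g q w ∨
      cycDist g a p + cycDist g a w = cycDist g p w := by
  rcases lt_or_ge a p with h | h
  · right; right; unfold cycDist; omega
  rcases lt_or_ge a q with h' | h'
  · left; unfold cycDist; omega
  rcases lt_or_ge a w with h'' | h''
  · right; left; unfold cycDist; omega
  · right; right; unfold cycDist; omega

/-- On the geodesic arc through `a`, the distances from `b` cannot sum to less, so `e = 0`. All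
three positions would then lie on one mirror axis, which meets the cycle at most twice. -/
theorem doublyResolves_triple {g p q w : ℕ} (hpq : p < q) (hqw : q < w) (hw : w < g)
    (h1 : 2 * (q - p) ≤ g) (h2 : 2 * (w - q) ≤ g) (h3 : g ≤ 2 * (w - p)) :
    DoublyResolves g {p, q, w} := by
  intro a ha b hb e hab H
  have hp : p < g := by omega
  have hq : q < g := by omega
  have le : ∀ t ∈ ({p, q, w} : Set ℕ), cycDist g b t ≤ cycDist g a t := by
    intro t ht
    rcases (H t ht).1 with rfl | h
    · simp [cycDist_self]
    · omega
  have strict : ∀ s ∈ ({p, q, w} : Set ℕ), ∀ t ∈ ({p, q, w} : Set ℕ), s < t → t < g →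
      cycDist g a s + cycDist g a t = cycDist g s t → e = 0 := by
    intro s hs t ht hst htg h
    have tri := cycDist_triangle (hst.trans htg) hb htg
    rw [cycDist_comm _ s b] at tri
    have := le s hs
    have := le t ht
    have := (H s hs).1
    have := (H t ht).1
    omega
  have e0 : e = 0 := by
    rcases exists_arc hpq hqw hw ha h1 h2 h3 with h | h | h
    · exact strict p (by simp) q (by simp) hpq hq h
    · exact strict q (by simp) w (by simp) hqw hw h
    · exact strict p (by simp) w (by simp) (hpq.trans hqw) hw h
  have refl : ∀ t ∈ ({p, q, w} : Set ℕ), t < g →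
      a + b = 2 * t ∨ a + b + g = 2 * t ∨ a + b = 2 * t + g := by
    intro t ht htg
    refine reflection_of_cycDist_eq ha hb htg hab (le_antisymm ?_ (le t ht))
    rcases (H t ht).2 e0 with rfl | h
    · simp [cycDist_self]
    · exact h
  have r1 := refl p (by simp) hp
  have r2 := refl q (by simp) hq
  have r3 := refl w (by simp) hw
  omega

/-- Two positions on a cycle extend by a third position other than `0` to a doubly resolving
triple, unless they are the two middle positions of an odd cycle. -/
theorem exists_doublyResolves {g p q : ℕ} (hp : 0 < p) (hpq : p < q) (hq : q < g)
    (h : ¬ (g = 2 * p + 1 ∧ q = p + 1)) :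
    ∃ w, 0 < w ∧ w < g ∧ DoublyResolves g {p, q, w} := by
  rcases le_or_gt g (2 * (q - p)) with h1 | h1
  · refine ⟨(p + q) / 2, by omega, by omega, ?_⟩
    rw [Set.pair_comm q]
    exact doublyResolves_triple (by omega) (by omega) hq (by omega) (by omega) (by omega)
  -- The third position is roughly antipodal to `q`. If it would be the forbidden `0`, then `g - 1`
  -- serves instead; this is where `h` is needed.
  rcases lt_trichotomy (q + g / 2) g with h2 | h2 | h2
  · exact ⟨q + g / 2, by omega, by omega, doublyResolves_triple hpq (by omega) (by omega)
      (by omega) (by omega) (by omega)⟩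
  · exact ⟨g - 1, by omega, by omega, doublyResolves_triple hpq (by omega) (by omega)
      (by omega) (by omega) (by omega)⟩
  · refine ⟨q + g / 2 - g, by omega, by omega, ?_⟩
    rw [Set.pair_comm q, Set.insert_comm]
    exact doublyResolves_triple (by omega) hpq hq (by omega) (by omega) (by omega)


/-! ### Avoiding `c 0` in a resolving set -/

/-- Coordinates on a graph whose only cycle is `c 0, …, c (g - 1)`: the vertex `x` hangs at height
`h x` on a tree rooted at `c (π x)`. -/
structure CycleCoordinates {V : Type*} (G : SimpleGraph V) (g : ℕ) (c : ℕ → V) (π h : V → ℕ) :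
    Prop where
  three_le : 3 ≤ g
  proj_lt : ∀ x, π x < g
  proj_cycle : ∀ i < g, π (c i) = i
  height_cycle : ∀ i < g, h (c i) = 0
  dist_proj : ∀ x, G.dist x (c (π x)) = h x
  dist_of_ne : ∀ x y, π x ≠ π y → G.dist x y = h x + cycDist g (π x) (π y) + h y

namespace CycleCoordinates

variable {V : Type*} {G : SimpleGraph V} {g : ℕ} {c : ℕ → V} {π h : V → ℕ}

theorem dist_cycle (P : CycleCoordinates G g c π h) (x : V) {i : ℕ} (hi : i < g) :
    G.dist x (c i) = h x + cycDist g (π x) i := by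
  by_cases hx : π x = i
  · rw [← hx, P.dist_proj, cycDist_self, add_zero]
  · rw [P.dist_of_ne x (c i) (by rwa [P.proj_cycle i hi]), P.proj_cycle i hi, P.height_cycle i hi,
      add_zero]

theorem dist_le (P : CycleCoordinates G g c π h) (hG : G.Connected) (x y : V) :
    G.dist x y ≤ h x + cycDist g (π x) (π y) + h y := by
  by_cases hxy : π x = π y
  · have := hG.dist_triangle (u := x) (v := c (π x)) (w := y)
    rw [P.dist_proj, hxy, SimpleGraph.dist_comm (u := c (π y)), P.dist_proj] at this
    rw [hxy]
    omega
  · exact (P.dist_of_ne x y hxy).le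

theorem exists_resolves_of_proj_ne (P : CycleCoordinates G g c π h) (hG : G.Connected)
    {T : Finset V} {W : Set ℕ} (hW : DoublyResolves g W) (hT : ∀ t ∈ W, ∃ s ∈ T, π s = t)
    (x y : V) (hxy : π x ≠ π y) : ∃ s ∈ T, Resolves G s x y := by
  wlog hle : h x ≤ h y generalizing x y
  · obtain ⟨s, hs, hr⟩ := this y x hxy.symm (by omega)
    exact ⟨s, hs, hr.symm⟩
  by_contra! H
  refine hW (π x) (P.proj_lt x) (π y) (P.proj_lt y) (h y - h x) hxy fun t ht => ?_
  obtain ⟨s, hs, rfl⟩ := hT t ht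
  have hd := not_not.1 (H s hs)
  constructor
  · rw [or_iff_not_imp_left]
    intro hne
    rw [P.dist_of_ne y s (Ne.symm hne)] at hd
    have := P.dist_le hG x s
    omega
  · intro he
    rw [or_iff_not_imp_left]
    intro hne
    rw [P.dist_of_ne x s (Ne.symm hne)] at hd
    have := P.dist_le hG y s
    omega

theorem resolves_of_height_ne (P : CycleCoordinates G g c π h) {s x y : V} (hxy : π x = π y)
    (hs : π s ≠ π x) (hne : h x ≠ h y) : Resolves G s x y := by
  unfold Resolves
  rw [P.dist_of_ne x s hs.symm, P.dist_of_ne y s (hxy ▸ hs.symm), hxy]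
  omega

variable [DecidableEq V]

/-- Different positions are handled by `W`, and different heights at one position by a member in
another tree. Vertices with equal coordinates are not resolved by `c 0`, so another member of `S`
resolves them. -/
theorem isResolvingSet_of_doublyResolves (P : CycleCoordinates G g c π h) (hG : G.Connected)
    {S T : Finset V} (hS : IsResolvingSet G S) (hST : S.erase (c 0) ⊆ T) {W : Set ℕ} (hW : DoublyResolves g W)
    (hT : ∀ t ∈ W, ∃ s ∈ T, π s = t) {p q : ℕ} (hp : p ∈ W) (hq : q ∈ W) (hpq : p ≠ q) :
    IsResolvingSet G T := by
  intro x y hxy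
  by_cases hπ : π x = π y
  swap
  · exact P.exists_resolves_of_proj_ne hG hW hT x y hπ
  by_cases hh : h x = h y
  · obtain ⟨s, hs, hr⟩ := hS x y hxy
    refine ⟨s, hST (Finset.mem_erase.2 ⟨?_, hs⟩), hr⟩
    rintro rfl
    apply hr
    have := P.three_le
    rw [P.dist_cycle x (by omega), P.dist_cycle y (by omega), hπ, hh]
  · by_cases hx : π x = p
    · obtain ⟨s, hs, hq'⟩ := hT q hq
      exact ⟨s, hs, P.resolves_of_height_ne hπ (by omega) hh⟩
    · obtain ⟨s, hs, hp'⟩ := hT p hp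
      exact ⟨s, hs, P.resolves_of_height_ne hπ (by omega) hh⟩

/-- If the resolving set contains vertices of the tree at `c 0` besides `c 0`, then `c 0` is
redundant. -/
theorem isResolvingSet_erase (P : CycleCoordinates G g c π h) (hG : G.Connected)
    {S : Finset V} (hS : IsResolvingSet G S) {t : V} (ht : t ∈ S.erase (c 0)) (ht0 : π t = 0) :
    IsResolvingSet G (S.erase (c 0)) := by
  have hg := P.three_le
  have dist0 : ∀ x, G.dist x (c 0) = h x + cycDist g (π x) 0 := fun x =>
    P.dist_cycle x (by omega)
  obtain ⟨r, hr, hr0⟩ : ∃ r ∈ S.erase (c 0), π r ≠ 0 := by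
    by_contra! H
    -- These two are mirror images in the axis through position `0`.
    obtain ⟨s, hs, hr⟩ := hS (c 1) (c (g - 1)) fun he => by
      have := congrArg π he
      rw [P.proj_cycle 1 (by omega), P.proj_cycle (g - 1) (by omega)] at this
      omega
    have hs0 : π s = 0 := by
      by_cases he : s = c 0
      · rw [he, P.proj_cycle 0 (by omega)]
      · exact H s (Finset.mem_erase.2 ⟨he, hs⟩)
    apply hr
    rw [SimpleGraph.dist_comm, P.dist_cycle s (by omega), SimpleGraph.dist_comm,
      P.dist_cycle s (by omega), hs0]
    unfold cycDist
    omega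
  intro x y hxy
  wlog hle : G.dist x (c 0) ≤ G.dist y (c 0) generalizing x y
  · obtain ⟨s, hs, hr⟩ := this y x hxy.symm (by omega)
    exact ⟨s, hs, hr.symm⟩
  obtain ⟨s, hs, hres⟩ := hS x y hxy
  by_cases he : s = c 0
  swap
  · exact ⟨s, Finset.mem_erase.2 ⟨he, hs⟩, hres⟩
  rw [he] at hres
  have hlt : G.dist x (c 0) < G.dist y (c 0) := lt_of_le_of_ne hle hres
  -- a geodesic from `y` to `s` through `c 0` is too long for `x`
  have key : ∀ s, G.dist y s = G.dist y (c 0) + G.dist (c 0) s → Resolves G s x y := by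
    intro s hys hxs
    have := hG.dist_triangle (u := x) (v := c 0) (w := s)
    omega
  have add : ∀ s, π s ≠ π y → π s = 0 ∨ π y = 0 →
      G.dist y s = G.dist y (c 0) + G.dist (c 0) s := by
    intro s hs h0
    rw [P.dist_of_ne y s hs.symm, SimpleGraph.dist_comm (u := c 0), dist0, dist0]
    rcases h0 with h0 | h0 <;> rw [h0]
    · rw [cycDist_self]; omega
    · rw [cycDist_self, cycDist_comm]; omega
  by_cases hy : π y = 0
  · exact ⟨r, hr, key r (add r (by omega) (Or.inr hy))⟩
  · exact ⟨t, ht, key t (add t (by omega) (Or.inl ht0))⟩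

/-- A resolving set that contains `c 0` and resolves a pendant at `c 0` from all other vertices
can avoid `c 0`. -/
theorem exists_isResolvingSet_notMem (P : CycleCoordinates G g c π h) (hG : G.Connected)
    {S : Finset V} (hS : IsResolvingSet G S) (h0 : c 0 ∈ S)
    (hpend : ∀ x, ∃ s ∈ S, G.dist x s ≠ G.dist (c 0) s + 1) :
    ∃ T : Finset V, IsResolvingSet G T ∧ T.card ≤ S.card ∧ c 0 ∉ T := by
  have hg := P.three_le
  by_cases hS0 : ∃ t ∈ S.erase (c 0), π t = 0
  · obtain ⟨t, ht, ht0⟩ := hS0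
    exact ⟨_, P.isResolvingSet_erase hG hS ht ht0, Finset.card_le_card (Finset.erase_subset _ _),
      Finset.notMem_erase _ _⟩
  push Not at hS0
  have extend : ∀ (w : ℕ) (W : Set ℕ), 0 < w → w < g → DoublyResolves g W →
      (∀ t ∈ W, t = w ∨ ∃ s ∈ S.erase (c 0), π s = t) →
      ∀ p ∈ W, ∀ q ∈ W, p ≠ q →
      ∃ T : Finset V, IsResolvingSet G T ∧ T.card ≤ S.card ∧ c 0 ∉ T := by
    intro w W hw hwg hW hT p hp q hq hpq
    refine ⟨insert (c w) (S.erase (c 0)), ?_, ?_, ?_⟩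
    · refine P.isResolvingSet_of_doublyResolves hG hS (Finset.subset_insert _ _) hW ?_ hp hq hpq
      intro t ht
      rcases hT t ht with rfl | ⟨s, hs, hst⟩
      · exact ⟨c t, Finset.mem_insert_self _ _, P.proj_cycle t hwg⟩
      · exact ⟨s, Finset.mem_insert_of_mem hs, hst⟩
    · rw [← Finset.card_erase_add_one h0]
      exact Finset.card_insert_le _ _
    · rw [Finset.mem_insert, not_or]
      refine ⟨fun he => ?_, Finset.notMem_erase _ _⟩
      have := congrArg π he
      rw [P.proj_cycle 0 (by omega), P.proj_cycle w hwg] at this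
      omega
  by_cases htwo : ∃ s ∈ S.erase (c 0), ∃ t ∈ S.erase (c 0), π s < π t ∧
      ¬ (g = 2 * π s + 1 ∧ π t = π s + 1)
  · obtain ⟨s, hs, t, ht, hst, hmid⟩ := htwo
    obtain ⟨w, hw, hwg, hW⟩ :=
      exists_doublyResolves (Nat.pos_of_ne_zero (hS0 s hs)) hst (P.proj_lt t) hmid
    refine extend w _ hw hwg hW ?_ (π s) (by simp) (π t) (by simp) hst.ne
    rintro _ (rfl | rfl | rfl)
    · exact Or.inr ⟨s, hs, rfl⟩
    · exact Or.inr ⟨t, ht, rfl⟩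
    · exact Or.inl rfl
  push Not at htwo
  -- the pendant is resolved from the neighbours of `c 0` on the cycle
  have near : ∀ i, i = 1 ∨ i = g - 1 →
      ∃ s ∈ S.erase (c 0), cycDist g i (π s) ≤ cycDist g 0 (π s) := by
    intro i hi
    obtain ⟨s, hs, hne⟩ := hpend (c i)
    have hig : i < g := by omega
    rw [SimpleGraph.dist_comm, P.dist_cycle s hig, SimpleGraph.dist_comm,
      P.dist_cycle s (by omega)] at hne
    have hs0 : s ≠ c 0 := by
      rintro rfl
      rw [P.proj_cycle 0 (by omega)] at hne
      apply hne
      unfold cycDist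
      omega
    refine ⟨s, Finset.mem_erase.2 ⟨hs0, hs⟩, ?_⟩
    have := P.proj_lt s
    rw [cycDist_comm g _ i, cycDist_comm g _ 0] at hne
    unfold cycDist at hne ⊢
    omega
  obtain ⟨s, hs, hs1⟩ := near 1 (Or.inl rfl)
  obtain ⟨t, ht, ht1⟩ := near (g - 1) (Or.inr rfl)
  have ps := Nat.pos_of_ne_zero (hS0 s hs)
  have pt := Nat.pos_of_ne_zero (hS0 t ht)
  have ls := P.proj_lt s
  have lt := P.proj_lt t
  have hs2 : 2 * π s ≤ g + 1 := by unfold cycDist at hs1; omega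
  have ht2 : g ≤ 2 * π t + 1 := by unfold cycDist at ht1; omega
  -- Any two different positions are now the two middle ones of an odd cycle.
  have hst := htwo s hs t ht
  have hts := htwo t ht s hs
  have hodd : ∃ r ∈ S.erase (c 0), g = 2 * π r + 1 ∨ g + 1 = 2 * π r := by
    -- Otherwise all positions are `0` or `g / 2`, both fixed by the reflection that swaps `c 1` and
    -- `c (g - 1)`.
    by_contra! H
    have h1 := H s hs
    have h2 := H t ht
    have heq : 2 * π s = g := by omega
    obtain ⟨r, hr, hres⟩ := hS (c 1) (c (g - 1)) fun he => by
      have := congrArg π he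
      rw [P.proj_cycle 1 (by omega), P.proj_cycle (g - 1) (by omega)] at this
      omega
    apply hres
    rw [SimpleGraph.dist_comm, P.dist_cycle r (by omega), SimpleGraph.dist_comm,
      P.dist_cycle r (by omega)]
    have : π r = 0 ∨ 2 * π r = g := by
      by_cases he : r = c 0
      · rw [he, P.proj_cycle 0 (by omega)]; exact Or.inl rfl
      · have hr' : r ∈ S.erase (c 0) := Finset.mem_erase.2 ⟨he, hr⟩
        have := htwo s hs r hr'
        have := htwo r hr' s hs
        omega
    unfold cycDist
    omega
  -- The neighbour of `c 0` at distance `k` from position `π r` completes a doubly resolving pair,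
  -- where `g = 2k + 1`.
  obtain ⟨r, hr, hr' | hr'⟩ := hodd
  · have hgr : cycDist g (π r) (g - 1) = π r := by unfold cycDist; omega
    generalize hk : π r = k at *
    subst hr'
    refine extend (2 * k + 1 - 1) _ (by omega) (by omega)
      (doublyResolves_pair (by omega) (by omega) (by omega) hgr) ?_ k (by simp) _
      (Set.mem_insert_of_mem _ rfl) (by omega)
    rintro _ (rfl | rfl)
    · exact Or.inr ⟨r, hr, hk⟩
    · exact Or.inl rfl
  · have hgr : cycDist g (π r) 1 = π r - 1 := by unfold cycDist; omega
    obtain ⟨k, hk⟩ : ∃ k, π r = k + 1 := ⟨π r - 1, by omega⟩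
    rw [hk] at hgr hr'
    obtain rfl : g = 2 * k + 1 := by omega
    refine extend 1 _ (by omega) (by omega)
      (doublyResolves_pair (by omega) (by omega) (by omega) hgr) ?_ (k + 1) (by simp) _
      (Set.mem_insert_of_mem _ rfl) (by omega)
    rintro _ (rfl | rfl)
    · exact Or.inr ⟨r, hr, hk⟩
    · exact Or.inl rfl

end CycleCoordinates
open SimpleGraph

/-! ### Coordinates on a unicyclic graph -/

section
variable {V : Type*} {G : SimpleGraph V}

/-- This gives lower bounds on distances: a function that changes by at most 1 along edges is
1-Lipschitz. -/
theorem le_add_dist_of_adj (hG : G.Connected) {f : V → ℤ} (hf : ∀ a b, G.Adj a b → f a ≤ f b + 1)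
    (x y : V) : f x ≤ f y + G.dist x y := by
  obtain ⟨p, hp⟩ := hG.exists_walk_length_eq_dist x y
  rw [← hp]
  clear hp
  induction p with
  | nil => simp
  | cons hadj p ih =>
    have := hf _ _ hadj
    rw [Walk.length_cons]
    push_cast
    omega

/-- An edge of `G` outside the only cycle is a bridge, so that two vertices of the cycle are not
connected by edges outside the cycle. -/
theorem eq_of_reachable_deleteEdges {a : V} {c : G.Walk a a}
    (huniq : ∀ (b : V) (d : G.Walk b b), d.IsCycle → d.edgeSet = c.edgeSet) {x y : V}
    (hx : x ∈ c.support) (hy : y ∈ c.support) (h : (G.deleteEdges c.edgeSet).Reachable x y) :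
    x = y := by
  classical
  obtain ⟨p, hp⟩ := h.exists_isPath
  cases p with
  | nil => rfl
  | @cons _ z _ hadj p =>
    exfalso
    rw [Walk.cons_isPath_iff] at hp
    rw [deleteEdges_adj] at hadj
    -- The path `p` and the intact cycle join the ends of `s(x, z)` without that edge, so it lies on
    -- a cycle.
    have hzy : (G.deleteEdges {s(x, z)}).Reachable z y := by
      have hle : G.deleteEdges c.edgeSet ≤ G := deleteEdges_le _
      refine ⟨(p.mapLe hle).toDeleteEdges _ fun e he hex => hp.2 ?_⟩
      rw [Set.mem_singleton_iff] at hex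
      subst hex
      rw [Walk.edges_mapLe_eq_edges] at he
      exact p.fst_mem_support_of_mem_edges he
    have hcyc : ∀ w ∈ c.support, (G.deleteEdges {s(x, z)}).Reachable a w := by
      intro w hw
      refine ⟨(c.takeUntil w hw).toDeleteEdges _ fun e he hex => hadj.2 ?_⟩
      rw [Set.mem_singleton_iff] at hex
      subst hex
      exact c.edges_takeUntil_subset_edges hw he
    obtain ⟨b, d, hd, hmem⟩ := adj_and_reachable_delete_edges_iff_exists_cycle.1
      ⟨hadj.1, ((hcyc x hx).symm.trans (hcyc y hy)).trans hzy.symm⟩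
    apply hadj.2
    rw [← huniq b d hd]
    exact hmem

theorem exists_reachable_deleteEdges (hG : G.Connected) {C : Set V} {E : Set (Sym2 V)}
    (hE : ∀ x y, s(x, y) ∈ E → x ∈ C) {v : V} (hv : v ∈ C) (x : V) :
    ∃ z ∈ C, (G.deleteEdges E).Reachable x z := by
  obtain ⟨p⟩ := hG.preconnected x v
  induction p with
  | nil => exact ⟨_, hv, Reachable.refl _⟩
  | @cons x y _ hadj p ih =>
    by_cases he : s(x, y) ∈ E
    · exact ⟨x, hE x y he, Reachable.refl _⟩
    · obtain ⟨z, hz, hyz⟩ := ih hv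
      exact ⟨z, hz, (Adj.reachable (deleteEdges_adj.2 ⟨hadj, he⟩)).trans hyz⟩

theorem dist_getVert_le (hG : G.Connected) {a b : V} (c : G.Walk a b) {i j : ℕ} (hij : i ≤ j)
    (hj : j ≤ c.length) : G.dist (c.getVert i) (c.getVert j) ≤ j - i := by
  induction j, hij using Nat.le_induction with
  | base => simp
  | succ j hij ih =>
    have h1 := ih (by omega)
    have h2 := (dist_eq_one_iff_adj.2 (c.adj_getVert_succ (i := j) (by omega))).le
    have h3 := hG.dist_triangle (u := c.getVert i) (v := c.getVert j) (w := c.getVert (j + 1))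
    omega

theorem dist_getVert_le_cycDist (hG : G.Connected) {a : V} (c : G.Walk a a) {i j : ℕ}
    (hi : i < c.length) (hj : j < c.length) :
    G.dist (c.getVert i) (c.getVert j) ≤ cycDist c.length i j := by
  wlog hij : i ≤ j generalizing i j
  · rw [dist_comm, cycDist_comm]
    exact this hj hi (by omega)
  have h1 := dist_getVert_le hG c hij hj.le
  have h2 := dist_getVert_le hG c hj.le le_rfl
  have h3 := dist_getVert_le hG c (Nat.zero_le i) hi.le
  have h4 := hG.dist_triangle (u := c.getVert i) (v := a) (w := c.getVert j)
  rw [Walk.getVert_length] at h2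
  rw [Walk.getVert_zero] at h3
  rw [dist_comm (v := a), dist_comm (u := a) (v := c.getVert j)] at h4
  unfold cycDist
  omega

theorem exists_cycleCoordinates (hG : IsUnicyclic G) {v : V} (hv : IsCycleVertex G v) :
    ∃ g c π h, CycleCoordinates G g c π h ∧ c 0 = v := by
  classical
  obtain ⟨hconn, a₀, c₀, hc₀, huniq₀⟩ := hG
  obtain ⟨a, c', hc', hvc⟩ := hv
  obtain ⟨c, hc, huniq⟩ : ∃ c : G.Walk v v, c.IsCycle ∧
      ∀ (b : V) (d : G.Walk b b), d.IsCycle → d.edgeSet = c.edgeSet :=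
    ⟨c'.rotate v hvc, hc'.rotate hvc, fun b d hd => by
      rw [huniq₀ b d hd, huniq₀ _ _ (hc'.rotate hvc)]⟩
  have hg := hc.three_le_length
  have hlen : c.getVert c.length = c.getVert 0 := by simp
  have hex : ∀ x, ∃ i < c.length, (G.deleteEdges c.edgeSet).Reachable x (c.getVert i) := by
    intro x
    obtain ⟨z, hz, hxz⟩ := exists_reachable_deleteEdges hconn (C := {z | z ∈ c.support})
      (E := c.edgeSet) (fun x y he => c.fst_mem_support_of_mem_edges he) c.start_mem_support x
    obtain ⟨i, rfl, hi⟩ := Walk.mem_support_iff_exists_getVert.1 hz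
    rcases hi.lt_or_eq with hi | hi
    · exact ⟨i, hi, hxz⟩
    · exact ⟨0, by omega, by rwa [hi, hlen] at hxz⟩
  choose π hπ hreach using hex
  have proj_eq : ∀ x i, i < c.length → (G.deleteEdges c.edgeSet).Reachable x (c.getVert i) →
      π x = i := by
    intro x i hi hxi
    refine hc.getVert_injOn' ?_ ?_ (eq_of_reachable_deleteEdges huniq (c.getVert_mem_support _)
      (c.getVert_mem_support _) ((hreach x).symm.trans hxi))
    · have := hπ x
      rw [Set.mem_ofPred_eq]; omega
    · rw [Set.mem_ofPred_eq]; omega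
  have proj_cycle : ∀ i < c.length, π (c.getVert i) = i := fun i hi =>
    proj_eq _ i hi (Reachable.refl _)
  have hstep : ∀ i < c.length, π (c.getVert (i + 1)) < c.length ∧
      c.getVert (π (c.getVert (i + 1))) = c.getVert (i + 1) ∧
      cycDist c.length i (π (c.getVert (i + 1))) = 1 := by
    intro i hi
    rcases Nat.lt_or_ge (i + 1) c.length with h | h
    · rw [proj_cycle _ h]
      refine ⟨h, rfl, ?_⟩
      unfold cycDist; omega
    · obtain h : i + 1 = c.length := by omega
      rw [h, hlen, proj_cycle 0 (by omega)]
      refine ⟨by omega, rfl, ?_⟩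
      unfold cycDist; omega
  have hadj : ∀ x y, G.Adj x y → π x = π y ∨
      (c.getVert (π x) = x ∧ c.getVert (π y) = y ∧ cycDist c.length (π x) (π y) = 1) := by
    intro x y hxy
    by_cases he : s(x, y) ∈ c.edges
    · right
      obtain ⟨i, hi, heq⟩ := c.mk_mem_edges_iff_exists.1 he
      obtain ⟨-, h2, h3⟩ := hstep i hi
      have h1 := proj_cycle i hi
      rcases Sym2.eq_iff.1 heq with ⟨rfl, rfl⟩ | ⟨rfl, rfl⟩
      · rw [h1]; exact ⟨rfl, h2, h3⟩
      · rw [h1, cycDist_comm]; exact ⟨h2, rfl, h3⟩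
    · left
      exact proj_eq x _ (hπ y) ((Adj.reachable (deleteEdges_adj.2 ⟨hxy, he⟩)).trans (hreach y))
  refine ⟨c.length, c.getVert, π, fun x => G.dist x (c.getVert (π x)), ?_, c.getVert_zero⟩
  refine ⟨hg, hπ, proj_cycle, fun i hi => by simp [proj_cycle i hi], fun x => rfl, ?_⟩
  intro x y hxy
  apply le_antisymm
  · have h1 := hconn.dist_triangle (u := x) (v := c.getVert (π x)) (w := y)
    have h2 := hconn.dist_triangle (u := c.getVert (π x)) (v := c.getVert (π y)) (w := y)
    have h3 := dist_getVert_le_cycDist hconn c (hπ x) (hπ y)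
    rw [dist_comm (u := c.getVert (π y))] at h2
    omega
  -- The height counts negatively in the tree of `y`, so `f x - f y` is exactly the claimed
  -- distance.
  · have key := le_add_dist_of_adj hconn (f := fun z => if π z = π y then
      -(G.dist z (c.getVert (π z)) : ℤ) else
      (G.dist z (c.getVert (π z)) : ℤ) + cycDist c.length (π z) (π y)) ?_ x y
    · simp only [if_neg hxy, if_true] at key
      omega
    · intro a b hab
      have hab1 := dist_eq_one_iff_adj.2 hab
      rcases hadj a b hab with h | ⟨ha, hb, h⟩
      · have t1 := hconn.dist_triangle (u := a) (v := b) (w := c.getVert (π b))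
        have t2 := hconn.dist_triangle (u := b) (v := a) (w := c.getVert (π b))
        rw [dist_comm (u := b) (v := a)] at t2
        rw [h]
        split_ifs <;> omega
      · rw [ha, hb, dist_self, dist_self]
        have t := cycDist_triangle (hπ a) (hπ b) (hπ y)
        split_ifs with h1 h2 h2
        · simp
        · simp; omega
        · rw [h2] at h; omega
        · omega

end

/-! ### Distances and resolving sets after attaching a pendant -/

section
variable {V : Type*} {G : SimpleGraph V} {v : V}

theorem attachPendant_connected (hG : G.Connected) : (attachPendant G v).Connected := by
  have hsome : ∀ x y, (attachPendant G v).Reachable (some x) (some y) := fun x y =>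
    (hG.preconnected x y).map (⟨some, fun h => h⟩ : G →g attachPendant G v)
  have hv : (attachPendant G v).Reachable none (some v) :=
    Adj.reachable (show pendantAdj G v none (some v) from rfl)
  refine (connected_iff _).2 ⟨?_, ⟨none⟩⟩
  rintro (_ | x) (_ | y)
  · exact Reachable.refl _
  · exact hv.trans (hsome v y)
  · exact (hsome x v).trans hv.symm
  · exact hsome x y

theorem le_add_dist_attachPendant (hG : G.Connected) (y : V) (x z : Option V) :
    (x.elim (G.dist v y + 1 : ℤ) fun a => G.dist a y) ≤
      (z.elim (G.dist v y + 1 : ℤ) fun a => G.dist a y) + (attachPendant G v).dist x z := by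
  refine le_add_dist_of_adj (f := fun x => x.elim (G.dist v y + 1 : ℤ) fun a => G.dist a y)
    (attachPendant_connected hG) ?_ x z
  rintro (_ | a) (_ | b) h
  · simp
  · obtain rfl : b = v := h
    simp
  · obtain rfl : a = v := h
    simp; omega
  · have := dist_eq_one_iff_adj.2 (show G.Adj a b from h)
    have := hG.dist_triangle (u := a) (v := b) (w := y)
    simp only [Option.elim_some]
    omega

theorem dist_attachPendant_some (hG : G.Connected) (x y : V) :
    (attachPendant G v).dist (some x) (some y) = G.dist x y := by
  apply le_antisymm
  · obtain ⟨p, hp⟩ := hG.exists_walk_length_eq_dist x y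
    rw [← hp, ← p.length_map (⟨some, fun h => h⟩ : G →g attachPendant G v)]
    exact dist_le _
  · have := le_add_dist_attachPendant (v := v) hG y (some x) (some y)
    simp only [Option.elim_some, dist_self] at this
    omega

theorem dist_attachPendant_none (hG : G.Connected) (y : V) :
    (attachPendant G v).dist none (some y) = G.dist v y + 1 := by
  apply le_antisymm
  · have h1 := (attachPendant_connected (v := v) hG).dist_triangle (u := none) (v := some v)
      (w := some y)
    have h2 : (attachPendant G v).dist none (some v) = 1 :=
      dist_eq_one_iff_adj.2 (show pendantAdj G v none (some v) from rfl)
    rw [dist_attachPendant_some hG] at h1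
    omega
  · have := le_add_dist_attachPendant (v := v) hG y none (some y)
    simp only [Option.elim_some, Option.elim_none, dist_self] at this
    omega

/-- In a resolving set of `G`, the vertex `v` can be exchanged for a pendant at `v`. -/
theorem isResolvingSet_attachPendant [DecidableEq V] (hG : G.Connected) {S : Finset V}
    (hS : IsResolvingSet G S) :
    IsResolvingSet (attachPendant G v) (insert none ((S.erase v).map Function.Embedding.some)) := by
  have hnone : ∀ x : V, Resolves (attachPendant G v) none (some x) none := by
    intro x
    unfold Resolves
    rw [dist_self, dist_comm, dist_attachPendant_none hG]
    omega
  rintro (_ | x) (_ | y) hxy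
  · exact absurd rfl hxy
  · exact ⟨none, Finset.mem_insert_self _ _, (hnone y).symm⟩
  · exact ⟨none, Finset.mem_insert_self _ _, hnone x⟩
  · obtain ⟨s, hs, hr⟩ := hS x y fun h => hxy (congrArg some h)
    unfold Resolves at hr
    by_cases hsv : s = v
    · refine ⟨none, Finset.mem_insert_self _ _, ?_⟩
      subst hsv
      unfold Resolves
      rw [dist_comm, dist_attachPendant_none hG, dist_comm (u := some y),
        dist_attachPendant_none hG, dist_comm, dist_comm (v := y)]
      omega
    · refine ⟨some s, Finset.mem_insert_of_mem (Finset.mem_map.2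
        ⟨s, Finset.mem_erase.2 ⟨hsv, hs⟩, rfl⟩), ?_⟩
      unfold Resolves
      rwa [dist_attachPendant_some hG, dist_attachPendant_some hG]

theorem exists_resolves_eraseNone {S : Finset (Option V)}
    (hS : IsResolvingSet (attachPendant G v) S) (hnone : none ∉ S) {x y : Option V} (hxy : x ≠ y) :
    ∃ s ∈ S.eraseNone, Resolves (attachPendant G v) (some s) x y := by
  obtain ⟨_ | s, hs, hr⟩ := hS x y hxy
  · exact absurd hs hnone
  · exact ⟨s, Finset.mem_eraseNone.2 hs, hr⟩

end

/-! ### Existence of metric bases and the main theorem -/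

theorem exists_isMetricBasis {V : Type*} [Finite V] {G : SimpleGraph V} (hG : G.Connected) :
    ∃ S : Finset V, IsMetricBasis G S := by
  classical
  have := Fintype.ofFinite V
  have huniv : IsResolvingSet G Finset.univ := fun x y hxy => by
    refine ⟨x, Finset.mem_univ _, ?_⟩
    unfold Resolves
    rw [dist_self]
    exact (hG.pos_dist_of_ne hxy.symm).ne
  obtain ⟨S, hS, hmin⟩ := Set.exists_min_image {S | IsResolvingSet G S} Finset.card
    (Set.toFinite _) ⟨_, huniv⟩
  exact ⟨S, hS, fun T hT => hmin T hT⟩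

end PendantForced

theorem mainTheorem12 {V : Type*} [Finite V] (G : SimpleGraph V)
    (hG : PendantForced.IsUnicyclic G) (v : V) (hv : PendantForced.IsCycleVertex G v)
    (hforced : PendantForced.IsBasisForced G v) :
    PendantForced.IsBasisForced (PendantForced.attachPendant G v) none := by
  classical
  have hconn := hG.1
  intro S' hS'
  by_contra hnone
  have hS : PendantForced.IsResolvingSet G S'.eraseNone := by
    intro x y hxy
    obtain ⟨s, hs, hr⟩ := PendantForced.exists_resolves_eraseNone hS'.1 hnone
      (x := some x) (y := some y) (fun h => hxy (Option.some.inj h))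
    refine ⟨s, hs, ?_⟩
    unfold PendantForced.Resolves at hr ⊢
    rwa [PendantForced.dist_attachPendant_some hconn,
      PendantForced.dist_attachPendant_some hconn] at hr
  have hmin : ∀ T : Finset V, PendantForced.IsResolvingSet G T → S'.eraseNone.card ≤ T.card := by
    obtain ⟨B, hB⟩ := PendantForced.exists_isMetricBasis hconn
    intro T hT
    have hBT := hB.2 T hT
    have hle := hS'.2 _ (PendantForced.isResolvingSet_attachPendant (v := v) hconn hB.1)
    have hins := Finset.card_insert_le none ((B.erase v).map Function.Embedding.some)
    -- As `v` is in `B`, the exchange does not increase the size.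
    rw [Finset.card_map, Finset.card_erase_add_one (hforced B hB)] at hins
    exact (Finset.card_eraseNone_le S').trans (hle.trans (hins.trans hBT))
  obtain ⟨g, c, π, h, P, rfl⟩ := PendantForced.exists_cycleCoordinates hG hv
  obtain ⟨T, hT, hcard, hcT⟩ := P.exists_isResolvingSet_notMem hconn hS (hforced _ ⟨hS, hmin⟩) <| by
    intro x
    obtain ⟨s, hs, hr⟩ := PendantForced.exists_resolves_eraseNone hS'.1 hnone
      (x := some x) (y := none) (by simp)
    refine ⟨s, hs, ?_⟩
    unfold PendantForced.Resolves at hr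
    rwa [PendantForced.dist_attachPendant_some hconn,
      PendantForced.dist_attachPendant_none hconn] at hr
  exact hcT (hforced T ⟨hT, fun U hU => hcard.trans (hmin U hU)⟩)
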